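/- Let $f\colon\mathbb R^n\times\mathbb R^m\to\mathbb R$ and $g=(g_1,\dots,g_q)\colon\mathbb R^n\times\mathbb R^m\to\mathbb R^q$ be continuous; all spaces carry the maximum norm. For $x\in\mathbb R^n$ put $$\Gamma(x)=\{y\in\mathbb R^m : g(x,y)\le 0\},\qquad S(x)=\operatorname{argmin}_{y}\{f(x,y) : y\in\Gamma(x)\},\qquad \varphi(x)=\inf_{y}\{f(x,y) : y\in\Gamma(x)\}\in\overline{\mathbb R},$$ $$g_0(x,y)=f(x,y)-\varphi(x),\qquad \Phi(x)=\{y\in\mathbb R^m : g_0(x,y)\le 0,\ g(x,y)\le 0\},\qquad \operatorname{dom}\Phi=\{x : \Phi(x)\neq\varnothing\}.$$ Let $\bar y\in S(\bar x)$ and assume the following. 1. $S$ is inner semicontinuous at $(\bar x,\bar y)$, i.e., for each sequence $x_k\to\bar x$ there is a sequence $y_k\to\bar y$ with $y_k\in S(x_k)$ for all sufficiently large $k$. 2. In a neighbourhood of $(\bar x,\bar y)$, the functions $f,g_1,\dots,g_q$ are locally Lipschitz continuous and continuously differentiable with respect to $y$, i.e., the partial gradients with respect to $y$ exist and are continuous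 as functions of $(x,y)$. 3. With $I(\bar x,\bar y)=\{i\in\{1,\dots,q\} : g_i(\bar x,\bar y)=0\}$, there is a neighbourhood $U$ of $(\bar x,\bar y)$ such that for each $J\subset I(\bar x,\bar y)\cup\{0\}$ the family $(\nabla_y g_i(x,y))_{i\in J}$ has constant rank on $U$. Then the R-regularity constraint qualification (RRCQ) holds at $(\bar x,\bar y)$, i.e., $\varphi$ is continuous in a neighbourhood of $\bar x$, and $\Phi$ is R-regular at $(\bar x,\bar y)$ with respect to $\operatorname{dom}\Phi$: there are $\kappa>0$ and $\varepsilon>0$ such that $$\operatorname{dist}(y,\Phi(x))\le\kappa\,\max\{0,\,g_0(x,y),\,g_1(x,y),\dots,g_q(x,y)\}$$ for all $(x,y)$ with $x\in\operatorname{dom}\Phi$ and $\|(x,y)-(\bar x,\bar y)\|_\infty<\varepsilon$. -/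

import Mathlib

open Filter Topology Set

/-- The space `ℝᵏ` with the maximum norm. -/
abbrev RVec (k : ℕ) : Type := Fin k → ℝ

/-- The domain of a set-valued mapping. -/
def svDom {X Y : Type*} (Υ : X → Set Y) : Set X := {x | (Υ x).Nonempty}

/-- The graph of a set-valued mapping. -/
def svGraph {X Y : Type*} (Υ : X → Set Y) : Set (X × Y) := {p | p.2 ∈ Υ p.1}

/-- Inner semicontinuity of a set-valued mapping at a point `(x₀, y₀)` of its graph. -/
def InnerSemicontinuousAt {n m : ℕ} (Υ : RVec n → Set (RVec m))
    (x₀ : RVec n) (y₀ : RVec m) : Prop :=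
  ∀ u : ℕ → RVec n, Tendsto u atTop (𝓝 x₀) →
    ∃ v : ℕ → RVec m, Tendsto v atTop (𝓝 y₀) ∧ ∀ᶠ k in atTop, v k ∈ Υ (u k)

/-- The set-valued mapping `x ↦ {y | hᵢ(x, y) ≤ 0 for all i}`. -/
def sublevelMap {n m : ℕ} {ι : Type*} (h : ι → RVec n → RVec m → EReal) :
    RVec n → Set (RVec m) :=
  fun x => {y | ∀ i, h i x y ≤ 0}

/-- R-regularity at `(x₀, y₀)` with respect to `Ω` of the mapping described by the functions `hᵢ`.
The distance to a set is taken with respect to the maximum norm, with value `∞` for the empty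
set; balls in the product space are balls for the maximum norm, too. -/
def IsRRegularAt {n m : ℕ} {ι : Type*} (h : ι → RVec n → RVec m → EReal)
    (x₀ : RVec n) (y₀ : RVec m) (Ω : Set (RVec n)) : Prop :=
  ∃ κ : ℝ, 0 < κ ∧ ∃ ε : ℝ, 0 < ε ∧
    ∀ (x : RVec n) (y : RVec m), (x, y) ∈ Metric.ball (x₀, y₀) ε → x ∈ Ω →
      ((Metric.infEDist y (sublevelMap h x) : ENNReal) : EReal)
        ≤ (κ : EReal) * max 0 (⨆ i, h i x y)

namespace LowerLevel

/-- The lower level feasible set mapping `Γ`. -/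
def feasibleMap {n m q : ℕ} (g : Fin q → RVec n → RVec m → ℝ) : RVec n → Set (RVec m) :=
  fun x => {y | ∀ i, g i x y ≤ 0}

/-- The lower level solution mapping `S`, that is, `S(x)` is the set of minimizers of `f(x, ·)`
over `Γ(x)`. -/
def solutionMap {n m q : ℕ} (f : RVec n → RVec m → ℝ) (g : Fin q → RVec n → RVec m → ℝ) :
    RVec n → Set (RVec m) :=
  fun x => {y | y ∈ feasibleMap g x ∧ IsMinOn (f x) (feasibleMap g x) y}

/-- The optimal value function `φ`, with values in the extended real line (`∞` if the lower level
problem is infeasible, `-∞` if it is unbounded from below). -/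
noncomputable def valueFunction {n m q : ℕ} (f : RVec n → RVec m → ℝ)
    (g : Fin q → RVec n → RVec m → ℝ) (x : RVec n) : EReal :=
  ⨅ y ∈ feasibleMap g x, (f x y : EReal)

/-- The functions `g₀ = f - φ` (index `none`) and `g₁, …, g_q` (indices `some i`). -/
noncomputable def constraints {n m q : ℕ} (f : RVec n → RVec m → ℝ)
    (g : Fin q → RVec n → RVec m → ℝ) : Option (Fin q) → RVec n → RVec m → EReal
  | none => fun x y => (f x y : EReal) - valueFunction f g x
  | some i => fun x y => (g i x y : EReal)

/-- The mapping `Φ(x) = {y | f(x, y) - φ(x) ≤ 0, g(x, y) ≤ 0}`. -/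
noncomputable def valueMap {n m q : ℕ} (f : RVec n → RVec m → ℝ)
    (g : Fin q → RVec n → RVec m → ℝ) : RVec n → Set (RVec m) :=
  sublevelMap (constraints f g)

/-- The R-regularity constraint qualification at `(x₀, y₀)`: the mapping `Φ` is R-regular at
`(x₀, y₀)` with respect to `dom Φ`. R-regularity is a property of mappings that are described by
continuous functions, so the continuity of `φ` around `x₀` is part of the condition. -/
def RRCQ {n m q : ℕ} (f : RVec n → RVec m → ℝ) (g : Fin q → RVec n → RVec m → ℝ)
    (x₀ : RVec n) (y₀ : RVec m) : Prop :=
  (∀ᶠ x in 𝓝 x₀, ContinuousAt (valueFunction f g) x) ∧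
    IsRRegularAt (constraints f g) x₀ y₀ (svDom (valueMap f g))

/-- The partial gradient `∇_y h(x, y)`, the vector of the partial derivatives. -/
noncomputable def gradY {n m : ℕ} (h : RVec n → RVec m → ℝ) (x : RVec n) (y : RVec m) : RVec m :=
  fun j => fderiv ℝ (h x) y (Pi.single j 1)

/-- `h` is locally Lipschitz continuous in a neighbourhood of `(x₀, y₀)`. -/
def LocLipschitzNear {n m : ℕ} (h : RVec n → RVec m → ℝ) (x₀ : RVec n) (y₀ : RVec m) : Prop :=
  ∃ U ∈ 𝓝 (x₀, y₀), LocallyLipschitzOn U (fun p : RVec n × RVec m => h p.1 p.2)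

/-- `h` is continuously differentiable with respect to `y` in a neighbourhood of `(x₀, y₀)`:
there, `h(x, ·)` is differentiable and `∇_y h` is continuous as a function of `(x, y)`. -/
def ContDiffYNear {n m : ℕ} (h : RVec n → RVec m → ℝ) (x₀ : RVec n) (y₀ : RVec m) : Prop :=
  ∀ᶠ p : RVec n × RVec m in 𝓝 (x₀, y₀),
    DifferentiableAt ℝ (h p.1) p.2 ∧
      ContinuousAt (fun p' : RVec n × RVec m => gradY h p'.1 p'.2) p

/-- The index set of the lower level inequality constraints that are active at `(x₀, y₀)`. -/
def activeSet {n m q : ℕ} (g : Fin q → RVec n → RVec m → ℝ) (x₀ : RVec n) (y₀ : RVec m) :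
    Set (Fin q) :=
  {i | g i x₀ y₀ = 0}

/-- The constant rank condition: for each `J ⊆ I(x₀, y₀) ∪ {0}`, the rank of the family
`(∇_y gᵢ(x, y))`, `i ∈ J`, does not depend on `(x, y)` in a neighbourhood of `(x₀, y₀)`.
The gradient of `g₀(x, ·)` is that of its real-valued version, which is the same function
whenever `φ(x)` is finite. -/
def ConstantRankNear {n m q : ℕ} (f : RVec n → RVec m → ℝ) (g : Fin q → RVec n → RVec m → ℝ)
    (x₀ : RVec n) (y₀ : RVec m) : Prop :=
  ∃ U ∈ 𝓝 (x₀, y₀), ∀ J ⊆ insert none (some '' activeSet g x₀ y₀), ∃ r : ℕ, ∀ p ∈ U,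
    Module.finrank ℝ (Submodule.span ℝ
      ((fun i => gradY (fun x y => (constraints f g i x y).toReal) p.1 p.2) '' J)) = r

end LowerLevel

/-! The core is a local error bound for a parametric system `h i x y ≤ 0`
(`exists_errorBound_of_constantRank`). Let `w` be a Euclidean projection of `y` onto the solution
set at `x`; inner semicontinuity keeps `w` near `y₀`. Multipliers at `w` itself are avoided:
penalization gives points `z → w` where `y - z`, up to a vanishing error, is a nonnegative
combination of gradients of constraints violated at `z`. By Carathéodory these gradients may be
taken linearly independent, and constant rank carries the independence over to `(x₀, y₀)`, so that
the multipliers are at most `‖y - z‖ / c` in the limit, with a uniform `c`. Pairing with `y - z` and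
linearizing at `z`, where the constraints involved are positive, bounds `dist y w` by a multiple of
the violation at `y`.

The bound is used twice. For `g` alone it yields continuity of `φ`; for `g₀, g` it is the
R-regularity. In the latter, `φ(x)` is constant in `y`, so the error bound needs no regularity of
`φ`. -/

/-! ### Conic combinations and coefficient bounds -/

/-- Carathéodory's theorem for cones: a nonnegative combination of a finite family of vectors is
a positive combination of a linearly independent subfamily. -/
theorem exists_linearIndepOn_sum_smul_eq {ι V : Type*} [AddCommGroup V] [Module ℝ V]
    (v : ι → V) (s : Finset ι) :
    ∀ c : ι → ℝ, (∀ i ∈ s, 0 ≤ c i) → ∃ t ⊆ s, ∃ d : ι → ℝ, (∀ i ∈ t, 0 < d i) ∧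
      LinearIndepOn ℝ v (t : Set ι) ∧ ∑ i ∈ t, d i • v i = ∑ i ∈ s, c i • v i := by
  classical
  induction s using Finset.strongInduction with
  | H s ih =>
    intro c hc
    have drop : ∀ c' : ι → ℝ, (∀ i ∈ s, 0 ≤ c' i) → (∃ i ∈ s, c' i = 0) →
        ∃ t ⊆ s, ∃ d : ι → ℝ, (∀ i ∈ t, 0 < d i) ∧
          LinearIndepOn ℝ v (t : Set ι) ∧ ∑ i ∈ t, d i • v i = ∑ i ∈ s, c' i • v i := by
      rintro c' hc' ⟨i, hi, hci⟩
      obtain ⟨t, ht, d, hd, hli, hsum⟩ := ih _ (Finset.erase_ssubset hi) c'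
        fun j hj => hc' j (Finset.mem_of_mem_erase hj)
      refine ⟨t, ht.trans (Finset.erase_subset _ _), d, hd, hli, hsum.trans ?_⟩
      exact Finset.sum_erase _ (by simp [hci])
    by_cases h0 : ∃ i ∈ s, c i = 0
    · exact drop c hc h0
    push Not at h0
    by_cases hli : LinearIndepOn ℝ v (s : Set ι)
    · exact ⟨s, subset_rfl, c, fun i hi => (hc i hi).lt_of_ne' (h0 i hi), hli, rfl⟩
    obtain ⟨a, ha, i₁, hi₁, hai₁⟩ : ∃ a : ι → ℝ, ∑ i ∈ s, a i • v i = 0 ∧ ∃ i ∈ s, 0 < a i := by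
      obtain ⟨a, ha, i, hi, hai⟩ := not_linearIndepOn_finset_iff.1 hli
      rcases lt_or_gt_of_ne hai with h | h
      · exact ⟨-a, by simp [ha], i, hi, by simpa using h⟩
      · exact ⟨a, ha, i, hi, h⟩
    -- Ratio test: the longest step along the dependency `a` that keeps all coefficients
    -- nonnegative; it annihilates the coefficient of `i₀`.
    obtain ⟨i₀, hi₀, hmin⟩ := Finset.exists_min_image (s.filter fun i => 0 < a i)
      (fun i => c i / a i) ⟨i₁, by simp [hi₁, hai₁]⟩
    rw [Finset.mem_filter] at hi₀
    have hτ : 0 ≤ c i₀ / a i₀ := div_nonneg (hc _ hi₀.1) hi₀.2.le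
    have key := drop (fun i => c i - c i₀ / a i₀ * a i) (fun i hi => ?_)
      ⟨i₀, hi₀.1, by field_simp [hi₀.2.ne']; simp⟩
    · simpa [sub_smul, Finset.sum_sub_distrib, mul_smul, ← Finset.smul_sum, ha] using key
    · rcases le_or_gt (a i) 0 with h | h
      · nlinarith [hc i hi, mul_nonneg hτ (neg_nonneg.2 h)]
      · have := hmin i (by simp [hi, h])
        rw [le_div_iff₀ h] at this
        linarith

/-- The coefficients of a linear combination of linearly independent vectors are controlled by
its norm. -/
theorem LinearIndepOn.exists_mul_sum_abs_le_norm {ι E : Type*} [NormedAddCommGroup E]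
    [NormedSpace ℝ E] {v : ι → E} {t : Finset ι} (h : LinearIndepOn ℝ v (t : Set ι)) :
    ∃ c > 0, ∀ a : ι → ℝ, c * ∑ i ∈ t, |a i| ≤ ‖∑ i ∈ t, a i • v i‖ := by
  obtain ⟨K, -, hK⟩ := (Fintype.linearCombination ℝ (fun i : t => v i)).exists_antilipschitzWith
    (LinearMap.ker_eq_bot.2 (linearIndependent_iff_injective_fintypeLinearCombination.1 h))
  refine ⟨(t.card * K + 1 : ℝ)⁻¹, by positivity, fun a => ?_⟩
  have h1 := hK.le_mul_dist (fun i : t => a i) 0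
  simp only [map_zero, dist_zero_right, Fintype.linearCombination_apply] at h1
  rw [Finset.sum_coe_sort t (fun i => a i • v i)] at h1
  rw [inv_mul_le_iff₀ (by positivity)]
  calc ∑ i ∈ t, |a i| ≤ ∑ i ∈ t, ‖fun i : t => a i‖ :=
        Finset.sum_le_sum fun i hi => norm_le_pi_norm (fun i : t => a i) ⟨i, hi⟩
    _ = t.card * ‖fun i : t => a i‖ := by simp
    _ ≤ t.card * (K * ‖∑ i ∈ t, a i • v i‖) := by gcongr
    _ ≤ _ := by nlinarith [norm_nonneg (∑ i ∈ t, a i • v i)]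

/-- The bound of `LinearIndepOn.exists_mul_sum_abs_le_norm` is stable under perturbations. -/
theorem LinearIndepOn.exists_eventually_mul_sum_abs_le_norm {ι E P : Type*}
    [NormedAddCommGroup E] [NormedSpace ℝ E] [TopologicalSpace P] {v : ι → P → E} {p : P}
    {t : Finset ι} (h : LinearIndepOn ℝ (fun i => v i p) (t : Set ι))
    (hv : ∀ i ∈ t, ContinuousAt (v i) p) :
    ∃ c > 0, ∀ᶠ p' in 𝓝 p, ∀ a : ι → ℝ, c * ∑ i ∈ t, |a i| ≤ ‖∑ i ∈ t, a i • v i p'‖ := by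
  obtain ⟨c, hc, hb⟩ := h.exists_mul_sum_abs_le_norm
  refine ⟨c / 2, by positivity, ?_⟩
  have hnear : ∀ᶠ p' in 𝓝 p, ∀ i ∈ t, dist (v i p') (v i p) < c / 2 :=
    (Filter.eventually_all_finset t).2 fun i hi =>
      Metric.tendsto_nhds.1 (hv i hi) _ (by positivity)
  filter_upwards [hnear] with p' hp' a
  have h1 : ‖∑ i ∈ t, a i • (v i p' - v i p)‖ ≤ c / 2 * ∑ i ∈ t, |a i| := by
    rw [Finset.mul_sum]
    refine norm_sum_le_of_le _ fun i hi => ?_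
    rw [norm_smul, Real.norm_eq_abs, ← dist_eq_norm, mul_comm]
    gcongr
    exact (hp' i hi).le
  have h2 : ∑ i ∈ t, a i • v i p = ∑ i ∈ t, a i • v i p' - ∑ i ∈ t, a i • (v i p' - v i p) := by
    simp [smul_sub]
  have h3 := norm_sub_le (∑ i ∈ t, a i • v i p') (∑ i ∈ t, a i • (v i p' - v i p))
  rw [← h2] at h3
  linarith [hb a]

/-! ### Penalization of the projection problem -/

/-- The derivative of the squared positive part. -/
theorem hasDerivAt_sq_max_zero (t : ℝ) :
    HasDerivAt (fun s : ℝ => max s 0 ^ 2) (2 * max t 0) t := by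
  rcases lt_trichotomy t 0 with h | rfl | h
  · rw [max_eq_right h.le, mul_zero]
    refine (hasDerivAt_const t (0 : ℝ)).congr_of_eventuallyEq ?_
    filter_upwards [eventually_lt_nhds h] with s hs
    simp [max_eq_right hs.le]
  · rw [hasDerivAt_iff_isLittleO]
    have : (fun s : ℝ => s ^ 2) =o[𝓝 0] fun s : ℝ => s :=
      Asymptotics.isLittleO_pow_id one_lt_two
    refine (Asymptotics.IsBigO.of_bound 1 (Eventually.of_forall fun s => ?_)).trans_isLittleO
      (by simpa using this)
    rcases le_total s 0 with hs | hs <;> simp [hs]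
    positivity
  · rw [max_eq_left h.le]
    refine (by simpa using hasDerivAt_pow 2 t :
      HasDerivAt (fun s : ℝ => s ^ 2) (2 * t) t).congr_of_eventuallyEq ?_
    filter_upwards [eventually_gt_nhds h] with s hs
    rw [max_eq_left hs.le]

/-- Quadratic penalization: near a feasible point `w` which is nearest to `y`, there are
approximate stationary points of the projection problem at which all the constraints with a
nonzero multiplier are violated. -/
theorem exists_penalized_stationary {ι E : Type*} [Fintype ι] [NormedAddCommGroup E]
    [InnerProductSpace ℝ E] [FiniteDimensional ℝ E] {φ : ι → E → ℝ} {G : ι → E → E}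
    (hφ : ∀ i, Continuous (φ i)) {w y : E} (hw : ∀ i, φ i w ≤ 0)
    (hmin : ∀ z, (∀ i, φ i z ≤ 0) → dist y w ≤ dist y z) {θ : ℝ} (hθ : 0 < θ)
    (hd : ∀ z ∈ Metric.ball w θ, ∀ i, HasFDerivAt (φ i) (innerSL ℝ (G i z)) z) :
    ∃ z, dist z w < θ ∧ ∃ a : ι → ℝ, (∀ i, 0 ≤ a i) ∧ (∀ i, a i ≠ 0 → 0 < φ i z) ∧
      y - z + (w - z) = ∑ i, a i • G i z := by
  have : ProperSpace E := FiniteDimensional.proper ℝ E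
  -- The term `‖z - w‖ ^ 2` makes `w` the unique feasible minimizer of `Q`, even if the projection
  -- of `y` is not unique.
  let Q : E → ℝ := fun z => ‖z - y‖ ^ 2 + ‖z - w‖ ^ 2
  let P : E → ℝ := fun z => ∑ i, max (φ i z) 0 ^ 2
  have hQc : Continuous Q := by fun_prop
  have hPc : Continuous P := by fun_prop
  have hP0 : ∀ z, 0 ≤ P z := fun z => Finset.sum_nonneg fun i _ => by positivity
  have hPw : P w = 0 := by simp [P, max_eq_right (hw _)]
  have hfeas : ∀ z, P z = 0 → ∀ i, φ i z ≤ 0 := by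
    intro z hz i
    have := (Finset.sum_eq_zero_iff_of_nonneg (fun i _ => by positivity)).1 hz i (Finset.mem_univ i)
    simpa using this
  -- Otherwise, counterexamples for `N → ∞` accumulate at a feasible point of the sphere with `Q z ≤
  -- Q w`, although `Q z ≥ Q w + θ ^ 2` there. Hence the penalized minimizer over the closed ball is
  -- interior.
  obtain ⟨ρ, hρ⟩ : ∃ N : ℕ, ∀ z ∈ Metric.sphere w θ, Q w < Q z + N * P z := by
    by_contra! hcon
    choose u hu hu' using hcon
    obtain ⟨z, hz, s, hs, hlim⟩ := (isCompact_sphere w θ).tendsto_subseq hu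
    have hQl : Tendsto (fun k => Q (u (s k))) atTop (𝓝 (Q z)) := (hQc.tendsto z).comp hlim
    have hPl : Tendsto (fun k => P (u (s k))) atTop (𝓝 (P z)) := (hPc.tendsto z).comp hlim
    have hQz : Q z ≤ Q w := le_of_tendsto' hQl fun k =>
      le_trans (by have := mul_nonneg (Nat.cast_nonneg (α := ℝ) (s k)) (hP0 (u (s k))); linarith)
        (hu' (s k))
    have hPz : P z = 0 := by
      refine le_antisymm ?_ (hP0 z)
      have h1 : Tendsto (fun k => Q w / (s k : ℝ)) atTop (𝓝 0) :=
        tendsto_const_nhds.div_atTop (tendsto_natCast_atTop_atTop.comp hs.tendsto_atTop)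
      refine le_of_tendsto_of_tendsto hPl h1 ?_
      filter_upwards [eventually_gt_atTop 0] with k hk
      have hk' : (0 : ℝ) < s k := by exact_mod_cast hk.trans_le (hs.id_le k)
      rw [le_div_iff₀ hk']
      have : 0 ≤ Q (u (s k)) := by positivity
      linarith [hu' (s k), mul_comm (P (u (s k))) (s k : ℝ)]
    have h2 := hmin z (hfeas z hPz)
    rw [dist_comm, dist_eq_norm, dist_comm, dist_eq_norm] at h2
    have h3 : ‖z - w‖ = θ := by simpa [dist_eq_norm] using hz
    have h4 : ‖w - y‖ ^ 2 ≤ ‖z - y‖ ^ 2 := by gcongr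
    simp only [Q, sub_self, norm_zero, h3] at hQz
    nlinarith
  obtain ⟨z, hzb, hz⟩ := (isCompact_closedBall w θ).exists_isMinOn
    ⟨w, Metric.mem_closedBall_self hθ.le⟩
    (f := fun z => Q z + ρ * P z) (by fun_prop)
  have hzw : Q z + ρ * P z ≤ Q w := by
    simpa [hPw] using hz (Metric.mem_closedBall_self hθ.le)
  have hzθ : dist z w < θ := by
    refine lt_of_le_of_ne hzb fun h => ?_
    exact absurd hzw (not_le.2 (hρ z h))
  -- The multipliers are read off from the gradient of `ρ * P`, after cancelling the factor 2 common
  -- to both gradients.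
  refine ⟨z, hzθ, fun i => ρ * max (φ i z) 0, fun i => by positivity, fun i hi => ?_, ?_⟩
  · by_contra! h
    simp [max_eq_right h] at hi
  have hloc : IsLocalMin (fun z => Q z + ρ * P z) z :=
    hz.isLocalMin (Metric.closedBall_mem_nhds_of_mem hzθ)
  have hQd : HasFDerivAt Q (innerSL ℝ ((2 : ℝ) • (z - y) + (2 : ℝ) • (z - w))) z := by
    have h1 := ((hasFDerivAt_id z).sub_const y).norm_sq.add ((hasFDerivAt_id z).sub_const w).norm_sq
    refine h1.congr_fderiv ?_
    ext v
    simp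
  have hPd : HasFDerivAt P (innerSL ℝ (∑ i, (2 * max (φ i z) 0) • G i z)) z := by
    have h1 : ∀ i ∈ Finset.univ, HasFDerivAt (fun z => max (φ i z) 0 ^ 2)
        ((2 * max (φ i z) 0) • innerSL ℝ (G i z)) z := fun i _ =>
      (hasDerivAt_sq_max_zero _).comp_hasFDerivAt z (hd z hzθ i)
    refine (HasFDerivAt.fun_sum h1).congr_fderiv ?_
    ext v
    simp
  have h0 := hloc.hasFDerivAt_eq_zero (hQd.add (hPd.const_mul (ρ : ℝ)))
  have h1 : (2 : ℝ) • (z - y) + (2 : ℝ) • (z - w)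
      + (ρ : ℝ) • ∑ i, (2 * max (φ i z) 0) • G i z = 0 := by
    refine ext_inner_right ℝ fun v => ?_
    have := congrArg (fun l => l v) h0
    simpa [inner_add_left, inner_sub_left, inner_smul_left, sum_inner] using this
  have h2 : (ρ : ℝ) • ∑ i, (2 * max (φ i z) 0) • G i z
      = (2 : ℝ) • ∑ i, ((ρ : ℝ) * max (φ i z) 0) • G i z := by
    simp only [Finset.smul_sum, smul_smul]
    exact Finset.sum_congr rfl fun i _ => by ring_nf
  rw [h2, ← smul_add, ← smul_add, smul_eq_zero_iff_right two_ne_zero] at h1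
  rw [← sub_eq_zero, ← neg_eq_zero, ← h1]
  abel

/-! ### Error bound under constant rank -/

/-- A finite family is independent exactly when its rank is its cardinality, so equal rank transfers
independence. -/
theorem LinearIndepOn.of_finrank_span_image_eq {ι V : Type*} [AddCommGroup V] [Module ℝ V]
    {v v' : ι → V} {t : Finset ι} (h : LinearIndepOn ℝ v (t : Set ι))
    (hr : Module.finrank ℝ (Submodule.span ℝ (v '' t))
      = Module.finrank ℝ (Submodule.span ℝ (v' '' t))) :
    LinearIndepOn ℝ v' (t : Set ι) := by
  have h1 := (linearIndependent_iff_card_eq_finrank_span (b := fun i : (t : Set ι) => v i)).1 h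
  refine (linearIndependent_iff_card_eq_finrank_span (b := fun i : (t : Set ι) => v' i)).2
    (h1.trans ?_)
  rwa [Set.finrank, Set.finrank, ← Set.image_eq_range, ← Set.image_eq_range]

/-- A mean value estimate, uniform with respect to a parameter. -/
theorem eventually_abs_sub_sub_inner_le {X E : Type*} [TopologicalSpace X]
    [NormedAddCommGroup E] [InnerProductSpace ℝ E] {h : X → E → ℝ} {G : X → E → E} {x₀ : X}
    {y₀ : E} (hd : ∀ᶠ p : X × E in 𝓝 (x₀, y₀), HasFDerivAt (h p.1) (innerSL ℝ (G p.1 p.2)) p.2)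
    (hG : ContinuousAt (fun p : X × E => G p.1 p.2) (x₀, y₀)) {η : ℝ} (hη : 0 < η) :
    ∃ r > 0, ∀ᶠ x in 𝓝 x₀, ∀ y ∈ Metric.ball y₀ r, ∀ z ∈ Metric.ball y₀ r,
      |h x y - h x z - inner ℝ (G x z) (y - z)| ≤ η * ‖y - z‖ := by
  have hnear : ∀ᶠ p : X × E in 𝓝 (x₀, y₀), dist (G p.1 p.2) (G x₀ y₀) < η / 2 :=
    Metric.tendsto_nhds.1 hG _ (by positivity)
  have := hd.and hnear
  rw [nhds_prod_eq] at this
  obtain ⟨pa, hpa, pb, hpb, hab⟩ := eventually_prod_iff.1 this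
  obtain ⟨r, hr, hball⟩ := Metric.eventually_nhds_iff_ball.1 hpb
  refine ⟨r, hr, ?_⟩
  filter_upwards [hpa] with x hx y hy z hz
  have := (convex_ball y₀ r).norm_image_sub_le_of_norm_hasFDerivWithin_le'
    (f := h x) (φ := innerSL ℝ (G x z)) (C := η)
    (fun u hu => (hab hx (hball u hu)).1.hasFDerivWithinAt) (fun u hu => ?_) hz hy
  · simpa using this
  · rw [← map_sub, innerSL_apply_norm, ← dist_eq_norm]
    have h1 := (hab hx (hball u hu)).2
    have h2 := (hab hx (hball z hz)).2
    exact (dist_triangle_right _ _ _).trans (by simp only at h1 h2; linarith)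

theorem exists_pos_forall_le {ι : Type*} [Finite ι] {r : ι → ℝ} (hr : ∀ i, 0 < r i) :
    ∃ R > 0, ∀ i, R ≤ r i := by
  have h : ∀ᶠ R in 𝓝[>] (0 : ℝ), 0 < R ∧ ∀ i, R ≤ r i :=
    Eventually.and self_mem_nhdsWithin
      (eventually_all.2 fun i => mem_of_superset (Ioc_mem_nhdsGT (hr i)) fun _ h => h.2)
  exact h.exists

/-- A local error bound for a parametric system of inequalities under a constant rank condition
on the gradients of the active constraints, if the solution set mapping is inner semicontinuous
at the reference point. -/
theorem exists_errorBound_of_constantRank {ι X E : Type*} [Fintype ι] [TopologicalSpace X]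
    [NormedAddCommGroup E] [InnerProductSpace ℝ E] [FiniteDimensional ℝ E]
    {h : ι → X → E → ℝ} {G : ι → X → E → E} {x₀ : X} {y₀ : E} {A : Set ι}
    (hcont : ∀ᶠ x in 𝓝 x₀, ∀ i, Continuous (h i x))
    (hd : ∀ i, ∀ᶠ p : X × E in 𝓝 (x₀, y₀),
      HasFDerivAt (h i p.1) (innerSL ℝ (G i p.1 p.2)) p.2)
    (hG : ∀ i, ContinuousAt (fun p : X × E => G i p.1 p.2) (x₀, y₀))
    (hA : ∀ i ∉ A, ∀ᶠ p : X × E in 𝓝 (x₀, y₀), h i p.1 p.2 ≤ 0)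
    (hrank : ∀ᶠ p : X × E in 𝓝 (x₀, y₀), ∀ J ⊆ A,
      Module.finrank ℝ (Submodule.span ℝ ((fun i => G i p.1 p.2) '' J))
        = Module.finrank ℝ (Submodule.span ℝ ((fun i => G i x₀ y₀) '' J)))
    (hisc : ∀ ε > 0, ∀ᶠ x in 𝓝 x₀, ∃ y, dist y y₀ < ε ∧ ∀ i, h i x y ≤ 0) :
    ∃ κ > 0, ∀ᶠ p : X × E in 𝓝 (x₀, y₀), ∀ m, 0 ≤ m → (∀ i, h i p.1 p.2 ≤ m) →
      ∃ z, (∀ i, h i p.1 z ≤ 0) ∧ dist p.2 z ≤ κ * m := by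
  have : ProperSpace E := FiniteDimensional.proper ℝ E
  have hmult : ∀ t : Finset ι, ∃ c > 0, ∀ᶠ p : X × E in 𝓝 (x₀, y₀),
      LinearIndepOn ℝ (fun i => G i x₀ y₀) (t : Set ι) →
        ∀ a : ι → ℝ, c * ∑ i ∈ t, |a i| ≤ ‖∑ i ∈ t, a i • G i p.1 p.2‖ := by
    intro t
    by_cases ht : LinearIndepOn ℝ (fun i => G i x₀ y₀) (t : Set ι)
    · obtain ⟨c, hc, hb⟩ := LinearIndepOn.exists_eventually_mul_sum_abs_le_norm
        (v := fun i (p : X × E) => G i p.1 p.2) (p := (x₀, y₀)) ht fun i _ => hG i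
      exact ⟨c, hc, hb.mono fun p hp _ => hp⟩
    · exact ⟨1, one_pos, Eventually.of_forall fun p hp => absurd hp ht⟩
  choose c' hc' hmult using hmult
  obtain ⟨c, hc, hcc'⟩ := exists_pos_forall_le hc'
  -- Accuracy `c / 2` lets the linearization error be absorbed: in the limit, `c * D ^ 2 ≤ D * (m +
  -- c / 2 * D)`, whence the constant `2 / c`.
  have hmv := fun i => eventually_abs_sub_sub_inner_le (hd i) (hG i) (half_pos hc)
  choose r' hr' hmv using hmv
  obtain ⟨R', hR', hRr'⟩ := exists_pos_forall_le hr'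
  have hnear : ∀ᶠ p : X × E in 𝓝 x₀ ×ˢ 𝓝 y₀,
      (∀ i, HasFDerivAt (h i p.1) (innerSL ℝ (G i p.1 p.2)) p.2) ∧
      (∀ i ∉ A, h i p.1 p.2 ≤ 0) ∧
      (∀ J ⊆ A, Module.finrank ℝ (Submodule.span ℝ ((fun i => G i p.1 p.2) '' J))
        = Module.finrank ℝ (Submodule.span ℝ ((fun i => G i x₀ y₀) '' J))) ∧
      (∀ t : Finset ι, LinearIndepOn ℝ (fun i => G i x₀ y₀) (t : Set ι) →
        ∀ a : ι → ℝ, c' t * ∑ i ∈ t, |a i| ≤ ‖∑ i ∈ t, a i • G i p.1 p.2‖) := by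
    rw [← nhds_prod_eq]
    refine (eventually_all.2 hd).and (Eventually.and ?_ (hrank.and (eventually_all.2 hmult)))
    refine eventually_all.2 fun i => ?_
    by_cases hi : i ∈ A
    · exact Eventually.of_forall fun _ h => absurd hi h
    · exact (hA i hi).mono fun _ h _ => h
  obtain ⟨pa, hpa, pb, hpb, hab⟩ := eventually_prod_iff.1 hnear
  obtain ⟨r, hr, hball⟩ := Metric.eventually_nhds_iff_ball.1 hpb
  obtain ⟨R, hR, hRr, hRR'⟩ : ∃ R > 0, R ≤ r ∧ R ≤ R' :=
    ⟨min r R', lt_min hr hR', min_le_left _ _, min_le_right _ _⟩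
  refine ⟨2 / c, by positivity, ?_⟩
  rw [nhds_prod_eq]
  -- With `y` and a feasible `y'` within `R / 4` of `y₀`, the projection `w` lies within `3 * R /
  -- 4`, which leaves `R / 4` for `z`.
  filter_upwards [(hpa.and (hcont.and ((eventually_all.2 hmv).and
    (hisc (R / 4) (by positivity))))).prod_mk (Metric.ball_mem_nhds y₀ (by positivity : 0 < R / 4))]
  rintro ⟨x, y⟩ ⟨⟨hx, hxc, hxmv, y', hy', hy'f⟩, hy⟩ m hm hym
  simp only [Metric.mem_ball] at hx hxc hxmv hy hym ⊢
  have hclosed : IsClosed {z | ∀ i, h i x z ≤ 0} := by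
    simp only [Set.ofPred_forall]
    exact isClosed_iInter fun i => isClosed_le (hxc i) continuous_const
  obtain ⟨w, hw, hwd⟩ := hclosed.exists_infDist_eq_dist ⟨y', hy'f⟩ y
  have hwmin : ∀ z, (∀ i, h i x z ≤ 0) → dist y w ≤ dist y z := fun z hz =>
    hwd ▸ Metric.infDist_le_dist_of_mem (s := {z | ∀ i, h i x z ≤ 0}) hz
  refine ⟨w, hw, ?_⟩
  have hwy₀ : dist w y₀ < 3 * R / 4 := by
    have h1 := hwmin y' hy'f
    have h2 := dist_triangle_right y y' y₀
    have h3 := dist_triangle_left w y₀ y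
    linarith
  rcases (dist_nonneg (x := y) (y := w)).eq_or_lt with hD | hD
  · rw [← hD]; positivity
  set D := dist y w with hDdef
  have hballR : ∀ {z θ}, θ < R / 4 → dist z w < θ → z ∈ Metric.ball y₀ R := by
    intro z θ hθ hz
    have := dist_triangle z w y₀
    rw [Metric.mem_ball]
    linarith
  have key : ∀ θ, 0 < θ → θ < R / 4 → θ < D →
      c * (D - θ) ^ 2 ≤ (D + 2 * θ) * (m + c / 2 * (D + θ)) + c * θ * (D + θ) := by
    intro θ hθ hθR hθD
    obtain ⟨z, hzw, a, ha, hpos, hsum⟩ := exists_penalized_stationary hxc hw hwmin hθ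
      (G := fun i => G i x) fun z hz i => (hab hx (hball z
        (Metric.ball_subset_ball hRr (hballR hθR hz)))).1 i
    have hzR := hballR hθR hzw
    obtain ⟨-, hzA, hzrank, hzmult⟩ := hab hx (hball z (Metric.ball_subset_ball hRr hzR))
    simp only at hzA hzrank hzmult
    obtain ⟨t, hts, d, hd0, hli, hdsum⟩ := exists_linearIndepOn_sum_smul_eq (fun i => G i x z)
      (Finset.univ.filter fun i => a i ≠ 0) a fun i _ => ha i
    have htpos : ∀ i ∈ t, 0 < h i x z := fun i hi => hpos i (by simpa using hts hi)
    have htA : (t : Set ι) ⊆ A := by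
      intro i hi
      by_contra hiA
      exact absurd (hzA i hiA) (not_le.2 (htpos i hi))
    rw [Finset.sum_filter_of_ne (fun i _ hi => left_ne_zero_of_smul hi), ← hsum] at hdsum
    -- Independence at `(x, z)` passes to `(x₀, y₀)` by constant rank; the perturbed coefficient
    -- bound then applies back at `(x, z)`.
    have hmul := hzmult t (hli.of_finrank_span_image_eq (hzrank t htA)) d
    rw [hdsum, Finset.sum_congr rfl fun i hi => abs_of_pos (hd0 i hi)] at hmul
    set s := ∑ i ∈ t, d i with hs
    have hs0 : 0 ≤ s := Finset.sum_nonneg fun i hi => (hd0 i hi).le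
    set N := ‖y - z‖ with hN
    have hN0 : 0 ≤ N := norm_nonneg _
    have hwz : ‖w - z‖ ≤ θ := by rw [← dist_eq_norm, dist_comm]; exact hzw.le
    have hcs : c * s ≤ N + θ := calc
      c * s ≤ c' t * s := by gcongr; exact hcc' t
      _ ≤ ‖y - z + (w - z)‖ := hmul
      _ ≤ N + θ := (norm_add_le _ _).trans (by gcongr)
    have hyR : y ∈ Metric.ball y₀ R := Metric.mem_ball.2 (by linarith)
    -- Violation at `z` pays off here: `h i x y - h i x z ≤ m`, because `h i x z > 0`.
    have hinner : ∀ i ∈ t, inner ℝ (G i x z) (y - z) ≤ m + c / 2 * N := by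
      intro i hi
      have hsub : Metric.ball y₀ R ⊆ Metric.ball y₀ (r' i) :=
        Metric.ball_subset_ball (hRR'.trans (hRr' i))
      have h1 := (abs_le.1 (hxmv i y (hsub hyR) z (hsub hzR))).1
      linarith [htpos i hi, hym i]
    have hN2 : N ^ 2 ≤ s * (m + c / 2 * N) + θ * N := by
      have h1 : N ^ 2 = inner ℝ (y - z + (w - z)) (y - z) - inner ℝ (w - z) (y - z) := by
        rw [inner_add_left, real_inner_self_eq_norm_sq]; ring
      have h2 : inner ℝ (y - z + (w - z)) (y - z) ≤ s * (m + c / 2 * N) := by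
        rw [← hdsum, sum_inner, hs, Finset.sum_mul]
        refine Finset.sum_le_sum fun i hi => ?_
        rw [real_inner_smul_left]
        exact mul_le_mul_of_nonneg_left (hinner i hi) (hd0 i hi).le
      have h3 : -inner ℝ (w - z) (y - z) ≤ θ * N :=
        ((neg_le_abs _).trans (abs_real_inner_le_norm _ _)).trans (by gcongr)
      linarith
    have hND : N ≤ D + θ := by
      rw [hN, hDdef, ← dist_eq_norm]
      have := dist_triangle_right y z w
      linarith
    have hDN : D - θ ≤ N := by
      rw [hN, hDdef, ← dist_eq_norm]
      have := dist_triangle y z w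
      linarith
    calc c * (D - θ) ^ 2 ≤ c * N ^ 2 := by gcongr
      _ ≤ c * (s * (m + c / 2 * N) + θ * N) := by gcongr
      _ = (c * s) * (m + c / 2 * N) + c * θ * N := by ring
      _ ≤ (N + θ) * (m + c / 2 * N) + c * θ * N := by gcongr
      _ ≤ (D + θ + θ) * (m + c / 2 * (D + θ)) + c * θ * (D + θ) := by gcongr
      _ = _ := by ring
  have hlim : c * (D - 0) ^ 2 ≤ (D + 2 * 0) * (m + c / 2 * (D + 0)) + c * 0 * (D + 0) := by
    have hl : Tendsto (fun θ : ℝ => c * (D - θ) ^ 2) (𝓝[>] 0) (𝓝 (c * (D - 0) ^ 2)) :=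
      (Continuous.tendsto (by fun_prop) 0).mono_left nhdsWithin_le_nhds
    have hu : Tendsto (fun θ : ℝ => (D + 2 * θ) * (m + c / 2 * (D + θ)) + c * θ * (D + θ))
        (𝓝[>] 0) (𝓝 ((D + 2 * 0) * (m + c / 2 * (D + 0)) + c * 0 * (D + 0))) :=
      (Continuous.tendsto (by fun_prop) 0).mono_left nhdsWithin_le_nhds
    refine le_of_tendsto_of_tendsto hl hu ?_
    filter_upwards [self_mem_nhdsWithin, Ioo_mem_nhdsGT (show (0 : ℝ) < R / 4 by positivity),
      Ioo_mem_nhdsGT hD] with θ h1 h2 h3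
    exact key θ h1 h2.2 h3.2
  have h1 : D * (c * D) ≤ D * (2 * m) := by linarith
  have h2 := le_of_mul_le_mul_left h1 hD
  rw [div_mul_eq_mul_div, le_div_iff₀ hc]
  linarith

/-! ### Transfer to the maximum norm -/

namespace LowerLevel

theorem hasFDerivAt_comp_ofLp {n m : ℕ} {h : RVec n → RVec m → ℝ} {x : RVec n}
    {z : EuclideanSpace ℝ (Fin m)} (hd : DifferentiableAt ℝ (h x) z.ofLp) :
    HasFDerivAt (fun z : EuclideanSpace ℝ (Fin m) => h x z.ofLp)
      (innerSL ℝ (WithLp.toLp 2 (gradY h x z.ofLp))) z := by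
  have h1 := hd.hasFDerivAt.comp z (EuclideanSpace.equiv (Fin m) ℝ).hasFDerivAt
  refine h1.congr_fderiv ?_
  ext v
  have h2 : v.ofLp = ∑ j, v.ofLp j • (Pi.single j 1 : RVec m) := by
    ext k; simp [Finset.sum_apply, Pi.single_apply]
  simp only [ContinuousLinearMap.comp_apply, innerSL_apply_apply, PiLp.inner_apply]
  change fderiv ℝ (h x) z.ofLp v.ofLp = _
  conv_lhs => rw [h2, map_sum]
  simp [gradY]

theorem finrank_span_toLp_image {m : ℕ} {ι : Type*} (v : ι → RVec m) (J : Set ι) :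
    Module.finrank ℝ (Submodule.span ℝ
      ((fun i => (WithLp.toLp 2 (v i) : EuclideanSpace ℝ (Fin m))) '' J))
        = Module.finrank ℝ (Submodule.span ℝ (v '' J)) := by
  have := LinearEquiv.finrank_map_eq (WithLp.linearEquiv 2 ℝ (RVec m)).symm
    (Submodule.span ℝ (v '' J))
  rw [← this, Submodule.map_span, Set.image_image]
  rfl

/-- The local error bound under the constant rank condition, for the maximum norm. -/
theorem exists_errorBound {n m : ℕ} {ι : Type*} [Fintype ι] {h : ι → RVec n → RVec m → ℝ}
    {x₀ : RVec n} {y₀ : RVec m} {A : Set ι} (hcont : ∀ i x, Continuous (h i x))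
    (hd : ∀ i, ContDiffYNear (h i) x₀ y₀)
    (hA : ∀ i ∉ A, ∀ᶠ p : RVec n × RVec m in 𝓝 (x₀, y₀), h i p.1 p.2 ≤ 0)
    (hrank : ∀ᶠ p : RVec n × RVec m in 𝓝 (x₀, y₀), ∀ J ⊆ A,
      Module.finrank ℝ (Submodule.span ℝ ((fun i => gradY (h i) p.1 p.2) '' J))
        = Module.finrank ℝ (Submodule.span ℝ ((fun i => gradY (h i) x₀ y₀) '' J)))
    (hisc : ∀ ε > 0, ∀ᶠ x in 𝓝 x₀, ∃ y, dist y y₀ < ε ∧ ∀ i, h i x y ≤ 0) :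
    ∃ κ > 0, ∀ᶠ p : RVec n × RVec m in 𝓝 (x₀, y₀), ∀ m, 0 ≤ m → (∀ i, h i p.1 p.2 ≤ m) →
      ∃ z, (∀ i, h i p.1 z ≤ 0) ∧ dist p.2 z ≤ κ * m := by
  have hto : Continuous (fun y : RVec m => (WithLp.toLp 2 y : EuclideanSpace ℝ (Fin m))) := PiLp.continuous_toLp 2 _
  have hof : Continuous (fun z : EuclideanSpace ℝ (Fin m) => z.ofLp) := PiLp.continuous_ofLp 2 _
  have hof' : Tendsto (fun p : RVec n × EuclideanSpace ℝ (Fin m) => (p.1, p.2.ofLp)) (𝓝 (x₀, WithLp.toLp 2 y₀))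
      (𝓝 (x₀, y₀)) := Continuous.tendsto (by fun_prop) _
  have hto' : Tendsto (fun p : RVec n × RVec m => (p.1, (WithLp.toLp 2 p.2 : EuclideanSpace ℝ (Fin m)))) (𝓝 (x₀, y₀))
      (𝓝 (x₀, WithLp.toLp 2 y₀)) := Continuous.tendsto (by fun_prop) _
  obtain ⟨κ, hκ, hb⟩ := exists_errorBound_of_constantRank (X := RVec n) (E := EuclideanSpace ℝ (Fin m))
    (h := fun i x z => h i x z.ofLp) (G := fun i x z => WithLp.toLp 2 (gradY (h i) x z.ofLp))
    (x₀ := x₀) (y₀ := WithLp.toLp 2 y₀) (A := A)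
    (Eventually.of_forall fun x i => (hcont i x).comp hof)
    (fun i => (hof'.eventually (hd i)).mono fun p hp => hasFDerivAt_comp_ofLp hp.1)
    (fun i => (hto.tendsto _).comp
      (Tendsto.comp (show ContinuousAt _ (x₀, y₀) from (hd i).self_of_nhds.2) hof'))
    (fun i hi => hof'.eventually (hA i hi))
    ((hof'.eventually hrank).mono fun p hp J hJ => by
      rw [finrank_span_toLp_image, finrank_span_toLp_image]; exact hp J hJ)
    (fun ε hε => by
      obtain ⟨δ, hδ, hδε⟩ := Metric.continuous_iff.1 hto y₀ ε hε
      filter_upwards [hisc δ hδ] with x ⟨y, hy, hyf⟩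
      exact ⟨WithLp.toLp 2 y, hδε y hy, hyf⟩)
  refine ⟨κ, hκ, ?_⟩
  filter_upwards [hto'.eventually hb] with p hp r hr hpr
  obtain ⟨z, hz, hdz⟩ := hp r hr hpr
  -- The Euclidean norm dominates the maximum norm, so `κ` is kept.
  refine ⟨z.ofLp, hz, le_trans ?_ hdz⟩
  simpa using (PiLp.lipschitzWith_ofLp 2 (fun _ : Fin m => ℝ)).dist_le_mul (WithLp.toLp 2 p.2) z

/-! ### Continuity of the optimal value function -/

theorem valueFunction_eq {n m q : ℕ} {f : RVec n → RVec m → ℝ} {g : Fin q → RVec n → RVec m → ℝ}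
    {x : RVec n} {y : RVec m} (hy : y ∈ solutionMap f g x) : valueFunction f g x = f x y :=
  le_antisymm (iInf₂_le y hy.1) (le_iInf₂ fun _ hz => EReal.coe_le_coe_iff.2 (hy.2 hz))

end LowerLevel

theorem InnerSemicontinuousAt.eventually_exists {n m : ℕ} {Υ : RVec n → Set (RVec m)}
    {x₀ : RVec n} {y₀ : RVec m} (h : InnerSemicontinuousAt Υ x₀ y₀) {ε : ℝ} (hε : 0 < ε) :
    ∀ᶠ x in 𝓝 x₀, ∃ y ∈ Υ x, dist y y₀ < ε := by
  refine eventually_iff_seq_eventually.2 fun u hu => ?_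
  obtain ⟨v, hv, hvu⟩ := h u hu
  filter_upwards [hvu, Metric.tendsto_nhds.1 hv ε hε] with k h1 h2
  exact ⟨v k, h1, h2⟩

namespace LowerLevel

/-- If the feasible set mapping admits a local error bound and the solution mapping is inner
semicontinuous, then the optimal value function is continuous around the reference point. -/
theorem eventually_continuousAt_valueFunction {n m q : ℕ} {f : RVec n → RVec m → ℝ}
    {g : Fin q → RVec n → RVec m → ℝ} {x₀ : RVec n} {y₀ : RVec m}
    (hf : Continuous (fun p : RVec n × RVec m => f p.1 p.2))
    (hg : ∀ i, Continuous (fun p : RVec n × RVec m => g i p.1 p.2))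
    (hisc : InnerSemicontinuousAt (solutionMap f g) x₀ y₀) {κ : ℝ}
    (hb : ∀ᶠ p : RVec n × RVec m in 𝓝 (x₀, y₀), ∀ m, 0 ≤ m → (∀ i, g i p.1 p.2 ≤ m) →
      ∃ z, (∀ i, g i p.1 z ≤ 0) ∧ dist p.2 z ≤ κ * m) :
    ∀ᶠ x in 𝓝 x₀, ContinuousAt (valueFunction f g) x := by
  have hfE : Continuous (fun p : RVec n × RVec m => (f p.1 p.2 : EReal)) :=
    continuous_coe_real_ereal.comp hf
  rw [nhds_prod_eq] at hb
  obtain ⟨pa, hpa, pb, hpb, hab⟩ := eventually_prod_iff.1 hb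
  obtain ⟨r, hr, hball⟩ := Metric.eventually_nhds_iff_ball.1 hpb
  filter_upwards [(hpa.and (hisc.eventually_exists hr)).eventually_nhds] with x hx
  obtain ⟨-, y, hy, hyr⟩ := hx.self_of_nhds
  refine tendsto_order.2 ⟨fun a ha => ?_, fun b hb => ?_⟩
  -- Lower semicontinuity: some minimizer for `x'` stays in a fixed compact ball, on which feasible
  -- values exceed `a` for `x'` near `x`.
  · have htube := (isCompact_closedBall y₀ r).eventually_forall_of_forall_eventually (x₀ := x)
      (P := fun x' y' => (∀ i, g i x' y' ≤ 0) → a < (f x' y' : EReal)) fun y' _ => by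
        by_cases hfeas : ∀ i, g i x y' ≤ 0
        · have : a < (f x y' : EReal) := ha.trans_le (iInf₂_le y' hfeas)
          filter_upwards [(hfE.tendsto (x, y')).eventually (lt_mem_nhds this)] with p hp _
          exact hp
        · push Not at hfeas
          obtain ⟨i, hi⟩ := hfeas
          filter_upwards [((hg i).tendsto (x, y')).eventually (lt_mem_nhds hi)] with p hp h
          exact absurd (h i) (not_le.2 hp)
    filter_upwards [htube, hx] with x' h1 ⟨_, y', hy', hyr'⟩
    rw [valueFunction_eq hy']
    exact h1 y' hyr'.le hy'.1
  -- Upper semicontinuity: a minimizer `y` for `x` is almost feasible for `x'`, and the error bound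
  -- moves it to a nearby feasible `z`.
  · rw [valueFunction_eq hy] at hb
    obtain ⟨γ, hγ, hγb⟩ := Metric.eventually_nhds_iff_ball.1
      ((hfE.tendsto (x, y)).eventually (gt_mem_nhds hb))
    have hm : Tendsto (fun x' => κ * ∑ i, max (g i x' y) 0) (𝓝 x) (𝓝 0) := by
      have h1 : ∀ i, Continuous fun x' => g i x' y := fun i =>
        (hg i).comp (Continuous.prodMk continuous_id continuous_const)
      have h2 : Continuous (fun x' => κ * ∑ i, max (g i x' y) 0) := by fun_prop
      have h3 := h2.tendsto x
      have h4 : ∀ i, max (g i x y) 0 = 0 := fun i => max_eq_right (hy.1 i)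
      simpa [h4] using h3
    filter_upwards [hx, Metric.ball_mem_nhds x hγ, hm.eventually (gt_mem_nhds hγ)]
      with x' hx' hxγ hmγ
    obtain ⟨z, hz, hdz⟩ := hab hx'.1 (hball y hyr) (∑ i, max (g i x' y) 0)
      (Finset.sum_nonneg fun i _ => le_max_right _ _) fun i =>
        (le_max_left _ _).trans (Finset.single_le_sum (f := fun i => max (g i x' y) 0)
          (fun i _ => le_max_right _ _) (Finset.mem_univ i))
    refine (iInf₂_le z hz).trans_lt (hγb (x', z) ?_)
    rw [← ball_prod_same]
    exact ⟨hxγ, Metric.mem_ball'.2 (hdz.trans_lt hmγ)⟩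

end LowerLevel

/-! ### Real-valued constraints and the RRCQ -/

namespace LowerLevel

/-- The real-valued version of the functions `g₀, g₁, …, g_q`. -/
noncomputable def realConstraints {n m q : ℕ} (f : RVec n → RVec m → ℝ)
    (g : Fin q → RVec n → RVec m → ℝ) : Option (Fin q) → RVec n → RVec m → ℝ
  | none => fun x y => f x y - (valueFunction f g x).toReal
  | some i => g i

/-- Where a minimizer exists, `φ(x)` is real, so the default value of `toReal` plays no role. -/
theorem constraints_eq_coe {n m q : ℕ} {f : RVec n → RVec m → ℝ}
    {g : Fin q → RVec n → RVec m → ℝ} {x : RVec n} (hx : (solutionMap f g x).Nonempty)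
    (i : Option (Fin q)) (y : RVec m) :
    constraints f g i x y = (realConstraints f g i x y : EReal) := by
  obtain ⟨z, hz⟩ := hx
  cases i <;> simp [constraints, realConstraints, valueFunction_eq hz]

theorem gradY_realConstraints_none {n m q : ℕ} (f : RVec n → RVec m → ℝ)
    (g : Fin q → RVec n → RVec m → ℝ) :
    gradY (realConstraints f g none) = gradY f := by
  funext x y j
  simp [gradY, realConstraints, fderiv_sub_const]

end LowerLevel

open LowerLevel in
theorem mainTheorem6 {n m q : ℕ}
    (f : RVec n → RVec m → ℝ) (g : Fin q → RVec n → RVec m → ℝ)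
    (hf : Continuous (fun p : RVec n × RVec m => f p.1 p.2))
    (hg : ∀ i, Continuous (fun p : RVec n × RVec m => g i p.1 p.2))
    (x₀ : RVec n) (y₀ : RVec m)
    (hS : (x₀, y₀) ∈ svGraph (LowerLevel.solutionMap f g))
    (hisc : InnerSemicontinuousAt (LowerLevel.solutionMap f g) x₀ y₀)
    (hfLip : LowerLevel.LocLipschitzNear f x₀ y₀)
    (hgLip : ∀ i, LowerLevel.LocLipschitzNear (g i) x₀ y₀)
    (hfC1 : LowerLevel.ContDiffYNear f x₀ y₀)
    (hgC1 : ∀ i, LowerLevel.ContDiffYNear (g i) x₀ y₀)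
    (hrank : LowerLevel.ConstantRankNear f g x₀ y₀) :
    LowerLevel.RRCQ f g x₀ y₀ := by
  have hS' : y₀ ∈ solutionMap f g x₀ := hS
  have hne : ∀ᶠ x in 𝓝 x₀, (solutionMap f g x).Nonempty :=
    (hisc.eventually_exists one_pos).mono fun x ⟨y, hy, _⟩ => ⟨y, hy⟩
  have hinactive : ∀ i ∉ activeSet g x₀ y₀,
      ∀ᶠ p : RVec n × RVec m in 𝓝 (x₀, y₀), g i p.1 p.2 ≤ 0 := fun i hi =>
    (((hg i).tendsto (x₀, y₀)).eventually
      (gt_mem_nhds (lt_of_le_of_ne (hS'.1 i) hi))).mono fun _ h => h.le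
  have hrank' : ∀ᶠ p : RVec n × RVec m in 𝓝 (x₀, y₀),
      ∀ J ⊆ insert none (some '' activeSet g x₀ y₀),
      Module.finrank ℝ (Submodule.span ℝ
        ((fun i => gradY (realConstraints f g i) p.1 p.2) '' J))
      = Module.finrank ℝ (Submodule.span ℝ
        ((fun i => gradY (realConstraints f g i) x₀ y₀) '' J)) := by
    obtain ⟨U, hU, hJ⟩ := hrank
    have hgrad : ∀ x, (solutionMap f g x).Nonempty → ∀ y i,
        gradY (fun x y => (constraints f g i x y).toReal) x y
          = gradY (realConstraints f g i) x y := by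
      intro x hx y i
      have h1 : (fun y => (constraints f g i x y).toReal) = realConstraints f g i x := by
        funext y
        rw [constraints_eq_coe hx, EReal.toReal_coe]
      funext j
      exact congrArg (fun φ => fderiv ℝ φ y (Pi.single j 1)) h1
    filter_upwards [hU, (continuous_fst.tendsto (x₀, y₀)).eventually hne] with p hpU hp J hJA
    obtain ⟨r, hr⟩ := hJ J hJA
    have h1 := hr p hpU
    have h2 := hr (x₀, y₀) (mem_of_mem_nhds hU)
    rw [funext fun i => hgrad _ hp p.2 i] at h1
    rw [funext fun i => hgrad _ ⟨y₀, hS'⟩ y₀ i] at h2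
    rw [h1, h2]
  refine ⟨?_, ?_⟩
  -- Rank condition for index sets without 0: only `g` is involved.
  · obtain ⟨κ, -, hb⟩ := exists_errorBound (h := g) (A := activeSet g x₀ y₀)
      (fun i x => (hg i).comp (Continuous.prodMk continuous_const continuous_id)) hgC1 hinactive
      (hrank'.mono fun p hp J hJ => by
        have := hp (some '' J) ((Set.image_mono hJ).trans (Set.subset_insert _ _))
        rwa [Set.image_image, Set.image_image] at this)
      (fun ε hε => (hisc.eventually_exists hε).mono fun x ⟨y, hy, hyε⟩ => ⟨y, hyε, hy.1⟩)
    exact eventually_continuousAt_valueFunction hf hg hisc hb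
  · obtain ⟨κ, hκ, hb⟩ := exists_errorBound (h := realConstraints f g)
      (x₀ := x₀) (y₀ := y₀) (A := insert none (some '' activeSet g x₀ y₀))
      (fun i x => by
        have hc : ∀ h : RVec n → RVec m → ℝ, Continuous (fun p : RVec n × RVec m => h p.1 p.2) →
            Continuous (h x) := fun h hh =>
          hh.comp (Continuous.prodMk continuous_const continuous_id)
        cases i with
        | none => exact (hc f hf).sub continuous_const
        | some i => exact hc _ (hg i))
      (fun i => by
        cases i with
        | none =>
          unfold ContDiffYNear at hfC1 ⊢
          rw [gradY_realConstraints_none]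
          exact hfC1.mono fun p hp => ⟨hp.1.sub_const _, hp.2⟩
        | some i => exact hgC1 i)
      (fun i hi => by
        cases i with
        | none => exact absurd (Set.mem_insert _ _) hi
        | some i =>
          exact hinactive i fun h => hi (Set.mem_insert_of_mem _ (Set.mem_image_of_mem _ h)))
      hrank'
      -- Minimizers satisfy `g₀ = 0`, so inner semicontinuity of `S` supplies points of `Φ(x)` near
      -- `y₀`.
      (fun ε hε => (hisc.eventually_exists hε).mono fun x ⟨y, hy, hyε⟩ => ⟨y, hyε, fun i => by
        cases i with
        | none => simp [realConstraints, valueFunction_eq hy]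
        | some i => exact hy.1 i⟩)
    obtain ⟨ε, hε, hball⟩ := Metric.eventually_nhds_iff_ball.1
      (hb.and ((continuous_fst.tendsto (x₀, y₀)).eventually hne))
    refine ⟨κ, hκ, ε, hε, fun x y hxy _ => ?_⟩
    obtain ⟨hxyb, hx⟩ := hball (x, y) hxy
    simp only [constraints_eq_coe hx]
    rcases eq_or_ne (max 0 (⨆ i, (realConstraints f g i x y : EReal))) ⊤ with htop | htop
    · rw [htop, EReal.coe_mul_top_of_pos hκ]
      exact le_top
    have hnn : 0 ≤ max 0 (⨆ i, (realConstraints f g i x y : EReal)) := le_max_left _ _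
    have hcoe := EReal.coe_toReal htop (ne_bot_of_le_ne_bot EReal.zero_ne_bot hnn)
    set r := (max 0 (⨆ i, (realConstraints f g i x y : EReal))).toReal with hr
    have hr0 : 0 ≤ r := EReal.toReal_nonneg hnn
    obtain ⟨z, hz, hdz⟩ := hxyb r hr0 fun i => by
      rw [← EReal.coe_le_coe_iff, hcoe]
      exact (le_iSup (fun i => (realConstraints f g i x y : EReal)) i).trans (le_max_right _ _)
    rw [← hcoe, ← EReal.coe_mul]
    have hzmem : z ∈ sublevelMap (constraints f g) x := fun i => by
      rw [constraints_eq_coe hx]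
      exact_mod_cast hz i
    have hle : Metric.infEDist y (sublevelMap (constraints f g) x) ≤ ENNReal.ofReal (κ * r) :=
      (Metric.infEDist_le_edist_of_mem hzmem).trans
        (by rw [edist_dist]; exact ENNReal.ofReal_le_ofReal hdz)
    refine (EReal.coe_ennreal_le_coe_ennreal_iff.2 hle).trans ?_
    rw [EReal.coe_ennreal_ofReal, max_eq_left (by positivity)]
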